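/- Let $\mathrm{LFP}$ be the (strict) 2-category whose objects are the locally finitely presentable categories (large, with small hom-sets), whose 1-cells $F:\mathcal{A}\to\mathcal{B}$ are the functors $F_*:\mathcal{A}\to\mathcal{B}$ that preserve small limits and small filtered colimits and have a left adjoint $F^*\dashv F_*$, and whose 2-cells $F\Rightarrow G$ are the natural transformations $F_*\Rightarrow G_*$. **Theorem.** Let $F:\mathcal{A}\to\mathcal{B}$ be a 1-cell of $\mathrm{LFP}$. Let $F_*\downarrow\mathcal{B}$ be the comma category of $F_*$ and $1_{\mathcal{B}}$: its objects are the triples $(A,B,f)$ with $f:F_*(A)\to B$ in $\mathcal{B}$, and its morphisms $(A,B,f)\to(A',B',f')$ are the pairs $(a:A\to A',\,b:B\to B')$ with $f'F_*(a)=bf$. Let $\pi_1:F_*\downarrow\mathcal{B}\to\mathcal{A}$ and $\mathrm{cod}:F_*\downarrow\mathcal{B}\to\mathcal{B}$ be the projections, and let $\lambda_F:F_*\pi_1\Rightarrow\mathrm{cod}$ be the natural transformation whose component at $(A,B,f)$ is $f$. Then: 1. $F_*\downarrow\mathcal{B}$ is a locally finitely presentable category. 2. $\pi_1$ and $\mathrm{cod}$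 preserve small limits and small filtered colimits and have left adjoints, so the square $(\pi_1,\mathrm{cod},\lambda_F)$ lies in $\mathrm{LFP}$. 3. This square is the comma object of $F$ and $1_{\mathcal{B}}$ in $\mathrm{LFP}$: for every object $\mathcal{C}$ of $\mathrm{LFP}$, the functor $$\mathrm{LFP}(\mathcal{C},F_*\downarrow\mathcal{B})\longrightarrow \mathrm{LFP}(\mathcal{C},F)\downarrow\mathrm{LFP}(\mathcal{C},\mathcal{B}),\qquad S\longmapsto(\pi_1S,\ \mathrm{cod}\,S,\ \lambda_FS),$$ is an isomorphism of categories, i.e. an equivalence that is bijective on objects. Here the target is the comma category of the functors $F\circ-:\mathrm{LFP}(\mathcal{C},\mathcal{A})\to\mathrm{LFP}(\mathcal{C},\mathcal{B})$ and $1_{\mathcal{B}}\circ-=\mathrm{id}$; its objects are the triples $(G,H,\lambda)$ with 1-cells $G:\mathcal{C}\to\mathcal{A}$, $H:\mathcal{C}\to\mathcal{B}$ and a 2-cell $\lambda:F_*G_*\Rightarrow H_*$. -/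

import Mathlib

open CategoryTheory CategoryTheory.Limits CategoryTheory.Bicategory

universe w

/-! ### Comma objects in a 2-category -/

section CommaObject

universe w₁ v₁ u₁

variable {K : Type u₁} [Bicategory.{w₁, v₁} K]

/-- For 1-cells `f : a ⟶ c`, `g : b ⟶ c` and a square with 1-cells `p : P ⟶ a`, `q : P ⟶ b` and
2-cell `lam : p ≫ f ⟶ q ≫ g`, the functor from `Hom(X, P)` to the comma category of
`Hom(X, f)` and `Hom(X, g)`, sending `u` to `(u ≫ p, u ≫ q, u ◁ lam)`. -/
def commaComparison {a b c P : K} (f : a ⟶ c) (g : b ⟶ c) (p : P ⟶ a) (q : P ⟶ b)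
    (lam : p ≫ f ⟶ q ≫ g) (X : K) :
    (X ⟶ P) ⥤ Comma (postcomp X f) (postcomp X g) where
  obj u :=
    { left := u ≫ p
      right := u ≫ q
      hom := (α_ u p f).hom ≫ u ◁ lam ≫ (α_ u q g).inv }
  map {u u'} t :=
    { left := t ▷ p
      right := t ▷ q
      w := by
        change t ▷ p ▷ f ≫ (α_ u' p f).hom ≫ u' ◁ lam ≫ (α_ u' q g).inv =
          ((α_ u p f).hom ≫ u ◁ lam ≫ (α_ u q g).inv) ≫ t ▷ q ▷ g
        simp only [Category.assoc, associator_naturality_left_assoc,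
          ← whisker_exchange_assoc, associator_inv_naturality_left] }
  map_id u := by
    ext <;> simp
  map_comp s t := by
    ext <;> simp

/-- The square `(P, p, q, lam)` is the comma object of `f` and `g` in the (strict) 2-category `K`:
for every object `X`, composition with it is an isomorphism of categories from `Hom(X, P)` to the
comma category of `Hom(X, f)` and `Hom(X, g)`, i.e. an equivalence which is bijective on objects.
-/
def IsCommaObject [Bicategory.Strict K] {a b c P : K} (f : a ⟶ c) (g : b ⟶ c)
    (p : P ⟶ a) (q : P ⟶ b) (lam : p ≫ f ⟶ q ≫ g) : Prop :=
  ∀ X : K, (commaComparison f g p q lam X).IsEquivalence ∧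
    Function.Bijective (commaComparison f g p q lam X).obj

end CommaObject

/-! ### The 2-category of locally finitely presentable categories -/

/-- An object of the 2-category `LFP`: a locally finitely presentable category. -/
structure LFPCat : Type (w + 2) where
  carrier : Type (w + 1)
  [category : Category.{w} carrier]
  [locallyFinitelyPresentable : IsLocallyFinitelyPresentable.{w} carrier]

namespace LFPCat

attribute [instance] category locallyFinitelyPresentable

/-- The functors which are (direct images of) morphisms of locally finitely presentable categories:
finitary continuous right adjoints. -/
structure IsMorphism {C D : Type (w + 1)} [Category.{w} C] [Category.{w} D] (F : C ⥤ D) :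
    Prop where
  isRightAdjoint : F.IsRightAdjoint
  continuous : PreservesLimitsOfSize.{w, w} F
  finitary : PreservesFilteredColimitsOfSize.{w, w} F

lemma IsMorphism.id (C : Type (w + 1)) [Category.{w} C] : IsMorphism (𝟭 C) :=
  ⟨inferInstance, inferInstance, inferInstance⟩

lemma IsMorphism.comp {C D E : Type (w + 1)} [Category.{w} C] [Category.{w} D] [Category.{w} E]
    {F : C ⥤ D} {G : D ⥤ E} (hF : IsMorphism F) (hG : IsMorphism G) : IsMorphism (F ⋙ G) := by
  obtain ⟨_, _, _⟩ := hF
  obtain ⟨_, _, _⟩ := hG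
  exact ⟨inferInstance, inferInstance, inferInstance⟩

/-- A 1-cell `F : A ⟶ B` of `LFP`, given by its direct image `F_* : A ⥤ B`. -/
@[ext]
structure Hom (A B : LFPCat.{w}) : Type (w + 1) where
  directImage : A.carrier ⥤ B.carrier
  isMorphism : IsMorphism directImage

/-- A 2-cell `F ⟶ G` of `LFP` is a natural transformation `F_* ⟶ G_*`. -/
@[ext]
structure Hom₂ {A B : LFPCat.{w}} (F G : Hom A B) : Type (w + 1) where
  natTrans : F.directImage ⟶ G.directImage

instance (A B : LFPCat.{w}) : Category (Hom A B) where
  Hom F G := Hom₂ F G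
  id F := ⟨𝟙 F.directImage⟩
  comp s t := ⟨s.natTrans ≫ t.natTrans⟩

@[ext]
lemma hom₂_ext {A B : LFPCat.{w}} {F G : Hom A B} {s t : F ⟶ G}
    (h : s.natTrans = t.natTrans) : s = t :=
  Hom₂.ext h

@[simp]
lemma id_natTrans {A B : LFPCat.{w}} (F : Hom A B) : (𝟙 F : F ⟶ F).natTrans = 𝟙 F.directImage :=
  rfl

@[simp]
lemma comp_natTrans {A B : LFPCat.{w}} {F G H : Hom A B} (s : F ⟶ G) (t : G ⟶ H) :
    (s ≫ t).natTrans = s.natTrans ≫ t.natTrans :=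
  rfl

/-- Natural isomorphisms of direct images are invertible 2-cells. -/
@[simps]
def isoMk {A B : LFPCat.{w}} {F G : Hom A B} (e : F.directImage ≅ G.directImage) : F ≅ G where
  hom := ⟨e.hom⟩
  inv := ⟨e.inv⟩

instance : Bicategory LFPCat.{w} where
  Hom A B := Hom A B
  id A := ⟨𝟭 A.carrier, .id _⟩
  comp F G := ⟨F.directImage ⋙ G.directImage, F.isMorphism.comp G.isMorphism⟩
  homCategory A B := inferInstance
  whiskerLeft F _ _ t := ⟨Functor.whiskerLeft F.directImage t.natTrans⟩
  whiskerRight t H := ⟨Functor.whiskerRight t.natTrans H.directImage⟩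
  associator F G H := isoMk (Functor.associator F.directImage G.directImage H.directImage)
  leftUnitor F := isoMk (Functor.leftUnitor F.directImage)
  rightUnitor F := isoMk (Functor.rightUnitor F.directImage)

instance : Bicategory.Strict LFPCat.{w} where
  id_comp _ := rfl
  comp_id _ := rfl
  assoc _ _ _ := rfl
  leftUnitor_eqToIso _ := rfl
  rightUnitor_eqToIso _ := rfl
  associator_eqToIso _ _ _ := rfl

end LFPCat

/-! As a comma object of plain categories the square is formal; the content is that everything stays
in `LFP`. As `F_*` need not preserve all colimits, colimits in the comma category are not
componentwise: a pushout corrects the second component (`isColimitPushoutCocone`). The projections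
have explicit left adjoints and are finitary, jointly faithful and jointly conservative, so these
left adjoints carry finitely presentable strong generators to one of the comma category
(`IsCardinalLocallyPresentable.of_adjunctions`). For a functor `S` with components `G_*`, `H_*`, a
left adjoint sends `(A, B, f)` to the pushout of `G^* A ← H^* F_* A → H^* B`, the first leg being
the mate of the structure 2-cell (`homEquivOfPushout`). Continuity follows, and `S` is finitary
because the projections jointly reflect filtered colimits. -/

namespace CategoryTheory.Comma

universe w' w₀ v₁ v₂ v₃ u₁ u₂ u₃

section

variable {A : Type u₁} [Category.{v₁} A] {B : Type u₂} [Category.{v₂} B] {L : A ⥤ B}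

/-! ### Cocompleteness of the comma category. -/

section Colimits

variable {J : Type w₀} [Category.{w'} J] (D : J ⥤ Comma L (𝟭 B))
  [HasColimit (D ⋙ snd L (𝟭 B))] [HasColimit ((D ⋙ fst L (𝟭 B)) ⋙ L)]

/-- The structure morphisms of a diagram in `Comma L (𝟭 B)`, on colimits. -/
noncomputable def colimitHom :
    colimit ((D ⋙ fst L (𝟭 B)) ⋙ L) ⟶ colimit (D ⋙ snd L (𝟭 B)) :=
  colimMap (Functor.whiskerLeft D (natTrans L (𝟭 B)) :)

@[simp]
lemma ι_colimitHom (j : J) :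
    colimit.ι ((D ⋙ fst L (𝟭 B)) ⋙ L) j ≫ colimitHom D =
      (D.obj j).hom ≫ colimit.ι (D ⋙ snd L (𝟭 B)) j := by
  simp [colimitHom]

variable [HasColimit (D ⋙ fst L (𝟭 B))] [HasPushouts B]

/-- The cocone over a diagram in `Comma L (𝟭 B)` whose first component is the colimit in `A`,
and whose second component is the pushout of the colimit in `B` which makes the structure
morphism factor through the image of the first component. -/
noncomputable def pushoutCocone : Cocone D where
  pt :=
    { left := colimit (D ⋙ fst L (𝟭 B))
      right := pushout (colimit.post (D ⋙ fst L (𝟭 B)) L) (colimitHom D)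
      hom := pushout.inl _ _ }
  ι :=
    { app j :=
        { left := colimit.ι (D ⋙ fst L (𝟭 B)) j
          right := colimit.ι (D ⋙ snd L (𝟭 B)) j ≫ pushout.inr _ _
          w := by
            have := colimit.ι ((D ⋙ fst L (𝟭 B)) ⋙ L) j ≫=
              pushout.condition (f := colimit.post (D ⋙ fst L (𝟭 B)) L) (g := colimitHom D)
            rw [colimit.ι_post_assoc, reassoc_of% ι_colimitHom] at this
            exact this }
      naturality i j f := by
        ext
        · simpa using colimit.w (D ⋙ fst L (𝟭 B)) f
        · simpa using colimit.w_assoc (D ⋙ snd L (𝟭 B)) f (pushout.inr _ _) }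

/-- The cocone `pushoutCocone D` is a colimit. -/
noncomputable def isColimitPushoutCocone : IsColimit (pushoutCocone D) where
  desc s :=
    { left := colimit.desc _ ((fst L (𝟭 B)).mapCocone s)
      right := pushout.desc (L.map (colimit.desc _ ((fst L (𝟭 B)).mapCocone s)) ≫ s.pt.hom)
        (colimit.desc _ ((snd L (𝟭 B)).mapCocone s)) (by
          ext j
          have := reassoc_of% (ι_colimitHom D j)
          simp [← Functor.map_comp_assoc, this])
      w := by simp [pushoutCocone, pushout.inl_desc] }
  fac s j := by
    ext <;> simp [pushoutCocone, pushout.inr_desc]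
  uniq s m hm := by
    have h₁ : m.left = colimit.desc _ ((fst L (𝟭 B)).mapCocone s) :=
      colimit.hom_ext fun j => by
        rw [colimit.ι_desc]
        exact congr_arg CommaMorphism.left (hm j)
    ext1
    · exact h₁
    · apply pushout.hom_ext
      · have := m.w
        simp [pushoutCocone] at this
        simp [← this, h₁, pushout.inl_desc]
      · refine colimit.hom_ext fun j => ?_
        rw [pushout.inr_desc, colimit.ι_desc]
        exact (Category.assoc _ _ _).symm.trans (congr_arg CommaMorphism.right (hm j))

end Colimits

/-- No preservation of colimits by `L` is needed for the cocompleteness of `Comma L (𝟭 B)`. -/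
lemma hasColimitsOfSize_of_hasPushouts [HasColimitsOfSize.{w', w₀} A] [HasColimitsOfSize.{w', w₀} B]
    [HasPushouts B] : HasColimitsOfSize.{w', w₀} (Comma L (𝟭 B)) where
  has_colimits_of_shape _ _ := ⟨fun D => ⟨⟨⟨_, isColimitPushoutCocone D⟩⟩⟩⟩

/-! ### Left adjoints of the two projections. -/

/-- The object `(X, L X, 𝟙)`, functorially in `X`. -/
@[simps]
def freeFst (L : A ⥤ B) : A ⥤ Comma L (𝟭 B) where
  obj X := { left := X, right := L.obj X, hom := 𝟙 _ }
  map f := { left := f, right := L.map f }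

/-- The functor `X ↦ (X, L X, 𝟙)` is left adjoint to the first projection. -/
def freeFstAdjunction (L : A ⥤ B) : freeFst L ⊣ fst L (𝟭 B) :=
  Adjunction.mkOfHomEquiv
    { homEquiv X Y :=
        { toFun f := f.left
          invFun g := { left := g, right := L.map g ≫ Y.hom, w := (Category.id_comp _).symm }
          left_inv f := by
            ext
            · rfl
            · exact f.w.trans (Category.id_comp _)
          right_inv _ := rfl }
      homEquiv_naturality_left_symm f g := by
        ext
        · rfl
        · exact (congr_arg (· ≫ _) (L.map_comp f g)).trans (Category.assoc _ _ _) }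

/-- The object `(⊥, L ⊥ ⨿ Y, inl)`, functorially in `Y`. -/
@[simps]
noncomputable def freeSnd (L : A ⥤ B) [HasInitial A] [HasBinaryCoproducts B] :
    B ⥤ Comma L (𝟭 B) where
  -- `L` need not preserve the initial object, hence the extra summand.
  obj Y := { left := ⊥_ A, right := L.obj (⊥_ A) ⨿ Y, hom := coprod.inl }
  map f := { left := 𝟙 _, right := coprod.map (𝟙 _) f }

/-- The functor `Y ↦ (⊥, L ⊥ ⨿ Y, inl)` is left adjoint to the second projection. -/
noncomputable def freeSndAdjunction (L : A ⥤ B) [HasInitial A] [HasBinaryCoproducts B] :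
    freeSnd L ⊣ snd L (𝟭 B) :=
  Adjunction.mkOfHomEquiv
    { homEquiv Y Z :=
        { toFun f := coprod.inr ≫ f.right
          invFun g :=
            { left := initial.to _
              right := coprod.desc (L.map (initial.to _) ≫ Z.hom) g
              w := (coprod.inl_desc _ _).symm }
          left_inv f := by
            ext
            · exact initial.hom_ext _ _
            · apply coprod.hom_ext
              · have := f.w
                rw [initial.hom_ext f.left (initial.to _)] at this
                exact (coprod.inl_desc _ _).trans this
              · exact coprod.inr_desc _ _
          right_inv g := coprod.inr_desc _ _ }
      homEquiv_naturality_left_symm f g := by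
        ext
        · exact initial.hom_ext _ _
        · exact ((coprod.map_desc _ _ _ _).trans (by rw [Category.id_comp]; rfl)).symm
      homEquiv_naturality_right f g := (Category.assoc _ _ _).symm }

variable {C : Type u₃} [Category.{v₃} C]

/-! ### Left adjoints of functors into the comma category. -/

section LeftAdjoint

variable (S : C ⥤ Comma L (𝟭 B)) {G : A ⥤ C} {H : B ⥤ C}
  (adjG : G ⊣ S ⋙ fst L (𝟭 B)) (adjH : H ⊣ S ⋙ snd L (𝟭 B))

/-- The mate of the structure 2-cell of `S`. -/
def mateHom (X : A) : H.obj (L.obj X) ⟶ G.obj X :=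
  (adjH.homEquiv _ _).symm (L.map (adjG.unit.app X) ≫ (S.obj (G.obj X)).hom)

/-- Transposing along `adjH` turns the first equation into the second: cocones on the pushout span
correspond to commuting squares. -/
lemma mateHom_comp_eq_iff (X : Comma L (𝟭 B)) {c : C} (g : G.obj X.left ⟶ c)
    (h : H.obj X.right ⟶ c) :
    mateHom S adjG adjH X.left ≫ g = H.map X.hom ≫ h ↔
      L.map (adjG.homEquiv _ _ g) ≫ (S.obj c).hom = X.hom ≫ adjH.homEquiv _ _ h := by
  rw [← (adjH.homEquiv _ _).apply_eq_iff_eq, adjH.homEquiv_naturality_left,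
    adjH.homEquiv_naturality_right, mateHom, Equiv.apply_symm_apply]
  simp [adjG.homEquiv_unit]

/-- Morphisms out of the pushout are the same as morphisms in the comma category. -/
@[simps]
noncomputable def homEquivOfPushout [HasPushouts C] (X : Comma L (𝟭 B)) (c : C) :
    (pushout (mateHom S adjG adjH X.left) (H.map X.hom) ⟶ c) ≃ (X ⟶ S.obj c) where
  toFun k :=
    { left := adjG.homEquiv _ _ (pushout.inl _ _ ≫ k)
      right := adjH.homEquiv _ _ (pushout.inr _ _ ≫ k)
      w := (mateHom_comp_eq_iff S adjG adjH X _ _).1 (by rw [pushout.condition_assoc]) }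
  invFun f := pushout.desc ((adjG.homEquiv _ _).symm f.left) ((adjH.homEquiv _ _).symm f.right)
    ((mateHom_comp_eq_iff S adjG adjH X _ _).2 (by
      rw [Equiv.apply_symm_apply, Equiv.apply_symm_apply]
      exact f.w))
  left_inv k := by
    apply pushout.hom_ext <;> simp [pushout.inl_desc, pushout.inr_desc]
  right_inv f := by
    ext <;> simp [pushout.inl_desc, pushout.inr_desc]

end LeftAdjoint

/-- A functor to `Comma L (𝟭 B)` is a right adjoint if both its components are. -/
lemma isRightAdjoint_of_comp_fst_of_comp_snd [HasPushouts C] (S : C ⥤ Comma L (𝟭 B))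
    [(S ⋙ fst L (𝟭 B)).IsRightAdjoint] [(S ⋙ snd L (𝟭 B)).IsRightAdjoint] :
    S.IsRightAdjoint :=
  (Adjunction.adjunctionOfEquivLeft
    (homEquivOfPushout S (Adjunction.ofIsRightAdjoint (S ⋙ fst L (𝟭 B)))
      (Adjunction.ofIsRightAdjoint (S ⋙ snd L (𝟭 B)))) (fun X c c' g h => by
        ext
        · simp [Adjunction.homEquiv_unit]
        · simp [Adjunction.homEquiv_unit])).isRightAdjoint

end

section

variable {A : Type u₁} [Category.{v₁} A] {B : Type u₂} [Category.{v₂} B]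
  {T : Type u₃} [Category.{v₃} T] {L : A ⥤ T} {R : B ⥤ T}

/-- The projections jointly reflect the colimits that `L` preserves. -/
lemma preservesColimitsOfShape_of_comp_fst_of_comp_snd {J : Type w₀} [Category.{w'} J]
    [PreservesColimitsOfShape J L] {C : Type*} [Category* C] (S : C ⥤ Comma L R)
    [PreservesColimitsOfShape J (S ⋙ fst L R)] [PreservesColimitsOfShape J (S ⋙ snd L R)] :
    PreservesColimitsOfShape J S where
  preservesColimit := ⟨fun hc => ⟨fstSndJointlyReflectColimit
    (isColimitOfPreserves (S ⋙ fst L R) hc) (isColimitOfPreserves (S ⋙ snd L R) hc)⟩⟩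

lemma obj_ext {X Y : Comma L R} (h₁ : X.left = Y.left) (h₂ : X.right = Y.right)
    (h : HEq X.hom Y.hom) : X = Y := by
  cases X
  cases Y
  dsimp at h₁ h₂
  subst h₁ h₂
  obtain rfl := eq_of_heq h
  rfl

lemma functor_ext {C : Type*} [Category* C] {S S' : C ⥤ Comma L R}
    (h₁ : S ⋙ fst L R = S' ⋙ fst L R) (h₂ : S ⋙ snd L R = S' ⋙ snd L R)
    (h : ∀ c, HEq (S.obj c).hom (S'.obj c).hom) : S = S' := by
  have hobj (c : C) : S.obj c = S'.obj c :=
    obj_ext (Functor.congr_obj h₁ c) (Functor.congr_obj h₂ c) (h c)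
  refine Functor.ext hobj fun c d f => ?_
  ext
  · simpa [eqToHom_left] using Functor.congr_hom h₁ f
  · simpa [eqToHom_right] using Functor.congr_hom h₂ f

end

end CategoryTheory.Comma

/-! ### Transfer of local presentability along two adjunctions. -/

namespace CategoryTheory

/-- Two right adjoint accessible functors to locally presentable categories which are jointly
faithful and jointly reflect isomorphisms make their source locally presentable. -/
lemma IsCardinalLocallyPresentable.of_adjunctions {C A B : Type*} [Category* C] [Category* A]
    [Category* B] [HasColimitsOfSize.{w, w} C] [LocallySmall.{w} C]
    (κ : Cardinal.{w}) [Fact κ.IsRegular] [IsCardinalLocallyPresentable A κ]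
    [IsCardinalLocallyPresentable B κ] {F₁ : A ⥤ C} {G₁ : C ⥤ A} {F₂ : B ⥤ C} {G₂ : C ⥤ B}
    (adj₁ : F₁ ⊣ G₁) (adj₂ : F₂ ⊣ G₂) [G₁.IsCardinalAccessible κ] [G₂.IsCardinalAccessible κ]
    (hfaithful : ∀ ⦃X Y : C⦄ (f g : X ⟶ Y), G₁.map f = G₁.map g → G₂.map f = G₂.map g → f = g)
    (hiso : ∀ ⦃X Y : C⦄ (f : X ⟶ Y), IsIso (G₁.map f) → IsIso (G₂.map f) → IsIso f) :
    IsCardinalLocallyPresentable C κ := by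
  obtain ⟨P₁, _, hP₁, hP₁'⟩ :=
    (IsCardinalLocallyPresentable.iff_exists_isStrongGenerator A κ).1 inferInstance
  obtain ⟨P₂, _, hP₂, hP₂'⟩ :=
    (IsCardinalLocallyPresentable.iff_exists_isStrongGenerator B κ).1 inferInstance
  rw [IsCardinalLocallyPresentable.iff_exists_isStrongGenerator]
  let Q₁ : ObjectProperty C := .ofObj (fun X : Subtype P₁ => F₁.obj X.1)
  let Q₂ : ObjectProperty C := .ofObj (fun X : Subtype P₂ => F₂.obj X.1)
  -- Maps out of `F₁ Z` and `F₂ Z` transpose to maps out of generators, so separation and detection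
  -- of isomorphisms reduce to `A` and `B`.
  refine ⟨Q₁ ⊔ Q₂, inferInstance, ?_, ?_⟩
  · rw [ObjectProperty.isStrongGenerator_iff]
    constructor
    · intro X Y f g hfg
      apply hfaithful
      · refine hP₁.isSeparating _ _ fun Z hZ h => ?_
        apply (adj₁.homEquiv _ _).symm.injective
        simp only [adj₁.homEquiv_naturality_right_symm]
        exact hfg _ (Or.inl ⟨⟨Z, hZ⟩⟩) _
      · refine hP₂.isSeparating _ _ fun Z hZ h => ?_
        apply (adj₂.homEquiv _ _).symm.injective
        simp only [adj₂.homEquiv_naturality_right_symm]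
        exact hfg _ (Or.inr ⟨⟨Z, hZ⟩⟩) _
    · intro X Y i _ hi
      -- Right adjoints preserve the monomorphism `i`, as `isIso_of_mono` requires.
      have := adj₁.isRightAdjoint
      have := adj₂.isRightAdjoint
      apply hiso
      · refine hP₁.isIso_of_mono _ fun Z hZ g => ?_
        obtain ⟨k, hk⟩ := hi _ (Or.inl ⟨⟨Z, hZ⟩⟩) ((adj₁.homEquiv _ _).symm g)
        refine ⟨adj₁.homEquiv _ _ k, ?_⟩
        dsimp at hk ⊢
        rw [← adj₁.homEquiv_naturality_right, hk, Equiv.apply_symm_apply]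
      · refine hP₂.isIso_of_mono _ fun Z hZ g => ?_
        obtain ⟨k, hk⟩ := hi _ (Or.inr ⟨⟨Z, hZ⟩⟩) ((adj₂.homEquiv _ _).symm g)
        refine ⟨adj₂.homEquiv _ _ k, ?_⟩
        dsimp at hk ⊢
        rw [← adj₂.homEquiv_naturality_right, hk, Equiv.apply_symm_apply]
  · rw [sup_le_iff]
    constructor
    · rintro _ ⟨⟨Z, hZ⟩⟩
      have : IsCardinalPresentable Z κ := hP₁' _ hZ
      exact adj₁.isCardinalPresentable_leftAdjoint_obj κ Z
    · rintro _ ⟨⟨Z, hZ⟩⟩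
      have : IsCardinalPresentable Z κ := hP₂' _ hZ
      exact adj₂.isCardinalPresentable_leftAdjoint_obj κ Z

end CategoryTheory

namespace LFPCat

variable {A B : LFPCat.{w}} (F : A ⟶ B)

lemma hasColimitsOfSize_carrier (A : LFPCat.{w}) : HasColimitsOfSize.{w, w} A.carrier :=
  A.locallyFinitelyPresentable.toHasColimitsOfSize

attribute [local instance] hasColimitsOfSize_carrier Cardinal.fact_isRegular_aleph0

instance hasFiniteColimits_carrier (A : LFPCat.{w}) : HasFiniteColimits A.carrier :=
  hasFiniteColimits_of_hasColimitsOfSize.{w, w} A.carrier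

lemma isMorphism_fst : IsMorphism (Comma.fst F.directImage (𝟭 B.carrier)) := by
  have := F.isMorphism.finitary
  have := (Comma.freeFstAdjunction F.directImage).isRightAdjoint
  exact ⟨inferInstance, inferInstance, ⟨fun J _ _ => inferInstance⟩⟩

lemma isMorphism_snd : IsMorphism (Comma.snd F.directImage (𝟭 B.carrier)) := by
  have := F.isMorphism.finitary
  have := (Comma.freeSndAdjunction F.directImage).isRightAdjoint
  exact ⟨inferInstance, inferInstance, ⟨fun J _ _ => inferInstance⟩⟩

lemma isLocallyFinitelyPresentable_comma :
    IsLocallyFinitelyPresentable.{w} (Comma F.directImage (𝟭 B.carrier)) := by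
  have : HasColimitsOfSize.{w, w} (Comma F.directImage (𝟭 B.carrier)) :=
    Comma.hasColimitsOfSize_of_hasPushouts
  have := Functor.IsFinitelyAccessible_iff_preservesFilteredColimitsOfSize.2
    (isMorphism_fst F).finitary
  have := Functor.IsFinitelyAccessible_iff_preservesFilteredColimitsOfSize.2
    (isMorphism_snd F).finitary
  exact IsCardinalLocallyPresentable.of_adjunctions _
    (Comma.freeFstAdjunction F.directImage) (Comma.freeSndAdjunction F.directImage)
    (fun _ _ _ _ h₁ h₂ => Comma.hom_ext _ _ h₁ h₂)
    (fun X Y f h₁ h₂ => by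
      have : IsIso f.left := h₁
      have : IsIso f.right := h₂
      exact (Comma.isoMk (asIso f.left) (asIso f.right) f.w).isIso_hom)

variable {F} in
/-- A functor to the comma category is a morphism as soon as its components are. -/
lemma isMorphism_of_comp_fst_of_comp_snd {C : LFPCat.{w}}
    (S : C.carrier ⥤ Comma F.directImage (𝟭 B.carrier))
    (h₁ : IsMorphism (S ⋙ Comma.fst F.directImage (𝟭 B.carrier)))
    (h₂ : IsMorphism (S ⋙ Comma.snd F.directImage (𝟭 B.carrier))) : IsMorphism S := by
  have := h₁.isRightAdjoint
  have := h₂.isRightAdjoint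
  have := h₁.finitary
  have := h₂.finitary
  have := F.isMorphism.finitary
  have := Comma.isRightAdjoint_of_comp_fst_of_comp_snd S
  exact ⟨inferInstance, inferInstance,
    ⟨fun J _ _ => Comma.preservesColimitsOfShape_of_comp_fst_of_comp_snd S⟩⟩

end LFPCat

theorem mainTheorem3 {A B : LFPCat.{w}} (F : A ⟶ B) :
    ∃ (_ : IsLocallyFinitelyPresentable.{w} (Comma F.directImage (𝟭 B.carrier)))
      (hfst : LFPCat.IsMorphism (Comma.fst F.directImage (𝟭 B.carrier)))
      (hcod : LFPCat.IsMorphism (Comma.snd F.directImage (𝟭 B.carrier))),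
      let P : LFPCat.{w} := ⟨Comma F.directImage (𝟭 B.carrier)⟩
      let π₁ : P ⟶ A := ⟨Comma.fst F.directImage (𝟭 B.carrier), hfst⟩
      let cod : P ⟶ B := ⟨Comma.snd F.directImage (𝟭 B.carrier), hcod⟩
      let lam : π₁ ≫ F ⟶ cod ≫ 𝟙 B := ⟨Comma.natTrans F.directImage (𝟭 B.carrier)⟩
      IsCommaObject F (𝟙 B) π₁ cod lam := by
  refine ⟨LFPCat.isLocallyFinitelyPresentable_comma F, LFPCat.isMorphism_fst F,
    LFPCat.isMorphism_snd F, ?_⟩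
  intro P π₁ cod lam X
  set K := commaComparison F (𝟙 B) π₁ cod lam X
  -- The associators in the comparison functor have identity components.
  have hom_app (S : X ⟶ P) (c : X.carrier) :
      (K.obj S).hom.natTrans.app c = (S.directImage.obj c).hom := by
    change 𝟙 _ ≫ (S.directImage.obj c).hom ≫ 𝟙 _ = _
    rw [Category.id_comp, Category.comp_id]
  have hbij : Function.Bijective K.obj := by
    constructor
    · intro S S' h
      refine LFPCat.Hom.ext (Comma.functor_ext (congr_arg (fun Y => Y.left.directImage) h)
        (congr_arg (fun Y => Y.right.directImage) h) fun c => ?_)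
      rw [← hom_app S, ← hom_app S']
      exact congr_arg_heq (fun Y => Y.hom.natTrans.app c) h
    · intro Y
      let S : X.carrier ⥤ Comma F.directImage (𝟭 B.carrier) :=
        { obj c :=
            { left := Y.left.directImage.obj c
              right := Y.right.directImage.obj c
              hom := Y.hom.natTrans.app c }
          map f :=
            { left := Y.left.directImage.map f
              right := Y.right.directImage.map f
              w := Y.hom.natTrans.naturality f } }
      -- The only non-formal point of the universal property: the induced functor is a 1-cell.
      refine ⟨⟨S, LFPCat.isMorphism_of_comp_fst_of_comp_snd S Y.left.isMorphism
        Y.right.isMorphism⟩, ?_⟩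
      refine Comma.obj_ext rfl rfl (heq_of_eq ?_)
      exact LFPCat.hom₂_ext (NatTrans.ext (funext fun c => hom_app _ c))
  have : K.Faithful := ⟨fun {S S'} t t' h => by
    refine LFPCat.hom₂_ext (NatTrans.ext (funext fun c => Comma.hom_ext _ _ ?_ ?_))
    · exact NatTrans.congr_app (congr_arg (fun g => g.left.natTrans) h) c
    · exact NatTrans.congr_app (congr_arg (fun g => g.right.natTrans) h) c⟩
  have : K.Full := ⟨fun {S S'} g =>
    ⟨⟨{ app c :=
          { left := g.left.natTrans.app c
            right := g.right.natTrans.app c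
            w := by
              have := NatTrans.congr_app (congr_arg (fun t => t.natTrans) g.w) c
              change F.directImage.map (g.left.natTrans.app c) ≫ (K.obj S').hom.natTrans.app c =
                (K.obj S).hom.natTrans.app c ≫ g.right.natTrans.app c at this
              rwa [hom_app, hom_app] at this }
        naturality c d f := by
          ext
          · exact g.left.natTrans.naturality f
          · exact g.right.natTrans.naturality f }⟩, rfl⟩⟩
  have : K.EssSurj := ⟨fun Y => (hbij.2 Y).imp fun S hS => ⟨eqToIso hS⟩⟩
  exact ⟨{}, hbij⟩
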